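/- For a connected graph $G$ on $n$ vertices, let $\partial_1(G)\ge\partial_2(G)\ge\cdots\ge\partial_n(G)$ be the eigenvalues, counted with multiplicity, of its distance matrix $D(G)=(d(u,v))_{u,v\in V(G)}$. Let $G$ be a finite simple connected graph of order $n\ge 4$ that is not complete and satisfies $-3\le\partial_n(G)$ and $\partial_3(G)\le -1$. Then at least one of the following holds: (I) $G\cong K_r\vee(K_{s_1}\cup\cdots\cup K_{s_i})$ for some integers $r\ge 1$, $i\ge 2$ and $s_1,\dots,s_i\ge 1$; (II) $G\cong (K_{s_1}\cup\cdots\cup K_{s_i})\vee(K_{t_1}\cup\cdots\cup K_{t_j})$ for some integers $i,j\ge 2$ and $s_1,\dots,s_i,t_1,\dots,t_j\ge 1$. Here $K_m$ is the complete graph on $m$ vertices, $\cup$ denotes disjoint union, and the join $H_1\vee H_2$ of two vertex-disjoint graphs is obtained from their disjoint union by adding all edges between a vertex of $H_1$ and a vertex of $H_2$. -/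

import Mathlib

universe u v

/-- The join `G ∨ H` of two vertex-disjoint graphs: the disjoint union of `G` and `H` together with
all edges between a vertex of `G` and a vertex of `H`. -/
def graphJoin {V : Type u} {W : Type v} (G : SimpleGraph V) (H : SimpleGraph W) :
    SimpleGraph (V ⊕ W) :=
  (G ⊕g H) ⊔ completeBipartiteGraph V W

/-- The disjoint union `K_{s 0} ∪ ⋯ ∪ K_{s (i-1)}` of complete graphs: two distinct vertices are
adjacent exactly when they lie in the same component. -/
def unionOfCompleteGraphs {i : ℕ} (s : Fin i → ℕ) : SimpleGraph (Σ k : Fin i, Fin (s k)) where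
  Adj x y := x ≠ y ∧ x.1 = y.1
  symm := ⟨fun _ _ h => ⟨h.1.symm, h.2.symm⟩⟩
  loopless := ⟨fun _ h => h.1 rfl⟩

/-- The distance matrix of a (connected) graph. -/
noncomputable def distanceMatrix {V : Type u} (G : SimpleGraph V) : Matrix V V ℝ :=
  Matrix.of fun x y => (G.dist x y : ℝ)

theorem distanceMatrix_isHermitian {V : Type u} (G : SimpleGraph V) :
    (distanceMatrix G).IsHermitian := by
  ext x y
  simp [distanceMatrix, SimpleGraph.dist_comm]

/-- The distance eigenvalues of `G`, with multiplicity and in non-increasing order. They are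
indexed from `0`, so `∂_k` is `distanceEigenvalue G` at the index `k - 1`. -/
noncomputable def distanceEigenvalue {V : Type u} [Fintype V] [DecidableEq V] (G : SimpleGraph V) :
    Fin (Fintype.card V) → ℝ :=
  (distanceMatrix_isHermitian G).eigenvalues₀

/-- `G` belongs to `𝒢[-3 ≤ ∂_n, ∂_3 ≤ -1]`: it is a non-complete connected graph of order
`n ≥ 4` with `-3 ≤ ∂_n(G)` and `∂_3(G) ≤ -1`. -/
structure IsInDistanceClass {V : Type u} [Fintype V] [DecidableEq V] (G : SimpleGraph V) :
    Prop where
  connected : G.Connected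
  not_complete : G ≠ ⊤
  four_le_card : 4 ≤ Fintype.card V
  neg_three_le_last : -3 ≤ distanceEigenvalue G ⟨Fintype.card V - 1, by omega⟩
  third_le_neg_one : distanceEigenvalue G ⟨2, by omega⟩ ≤ -1

/-! The bound `-3 ≤ ∂_n` serves only to force diameter at most two: a geodesic on four vertices has
a distance matrix with least eigenvalue `-2 - √2 < -3`. In diameter two, `D + I = J + A(Gᶜ)`, so
`∂_3 ≤ -1` says that `J + A(Gᶜ)` has at most two positive eigenvalues, and hence is positive
definite on no three-dimensional space of vectors.

Explicit three-parameter families on five vertices thus exclude `2K₂ ∪ K₁`, `P₄ ∪ K₁`, `P₅`, `C₅`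
and paw `∪ K₁` as induced subgraphs of `Gᶜ`. Both ends of any edge of `Gᶜ` miss some common vertex,
since nonadjacent vertices of `G` have a common neighbour; this upgrades the list to `P₄` and the
paw themselves (`not_compl_path_four`, `not_compl_paw`). Every nontrivial component of `Gᶜ` is then
complete multipartite, so it induces a union of cliques in `G`, and distinct components are joined
completely in `G`. By `not_compl_two_edges_and_isolated`, either `Gᶜ` has exactly two components,
both nontrivial (II), or it has one nontrivial component and the remaining vertices form a clique of
`G` (I). -/

/-! ### Eigenvalue bounds and quadratic forms on a few coordinates. -/

open Matrix in
/-- Spectral expansion of a real symmetric quadratic form along an eigenbasis indexed like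
`Matrix.IsHermitian.eigenvalues₀`. -/
theorem exists_spectral_expansion {n : Type*} [Fintype n] [DecidableEq n] {A : Matrix n n ℝ}
    (hA : A.IsHermitian) :
    ∃ e : Fin (Fintype.card n) → n → ℝ, ∀ x : n → ℝ,
      x ⬝ᵥ x = ∑ i, (e i ⬝ᵥ x) ^ 2 ∧
      x ⬝ᵥ (A *ᵥ x) = ∑ i, hA.eigenvalues₀ i * (e i ⬝ᵥ x) ^ 2 := by
  have hT := isSymmetric_toEuclideanLin_iff.mpr hA
  set b := hT.eigenvectorBasis finrank_euclideanSpace with hb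
  have hin : ∀ (i) (x : n → ℝ), inner ℝ (b i) (WithLp.toLp 2 x) = (b i).ofLp ⬝ᵥ x := by
    intro i x
    rw [EuclideanSpace.inner_eq_star_dotProduct, dotProduct_comm]
    simp
  refine ⟨fun i => (b i).ofLp, fun x => ⟨?_, ?_⟩⟩
  · have h := b.sum_inner_mul_inner (WithLp.toLp 2 x) (WithLp.toLp 2 x)
    rw [EuclideanSpace.inner_eq_star_dotProduct] at h
    simp only [star_trivial] at h
    rw [← h]
    refine Finset.sum_congr rfl fun i _ => ?_
    rw [real_inner_comm, hin, sq]
  · have h := b.sum_inner_mul_inner (WithLp.toLp 2 x) (toEuclideanLin A (WithLp.toLp 2 x))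
    have hx : inner ℝ (WithLp.toLp 2 x) (toEuclideanLin A (WithLp.toLp 2 x)) = x ⬝ᵥ (A *ᵥ x) := by
      rw [EuclideanSpace.inner_eq_star_dotProduct, dotProduct_comm]
      simp [toLpLin_apply]
    rw [← hx, ← h]
    refine Finset.sum_congr rfl fun i _ => ?_
    have hi : toEuclideanLin A (b i) = hA.eigenvalues₀ i • b i :=
      hT.apply_eigenvectorBasis finrank_euclideanSpace i
    rw [← hT, hi, real_inner_comm, inner_smul_left, hin]
    simp only [conj_trivial]
    ring

open Matrix in
/-- A vector supported on the image of an injection, with its pairings and quadratic forms. -/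
theorem exists_extension_of_injective {n : Type*} [Fintype n] [DecidableEq n] {k : ℕ}
    {f : Fin k → n} (hf : Function.Injective f) (w : Fin k → ℝ) :
    ∃ x : n → ℝ, (∀ g : n → ℝ, x ⬝ᵥ g = ∑ i, w i * g (f i)) ∧ x ⬝ᵥ x = ∑ i, w i ^ 2 ∧
      ∀ A : Matrix n n ℝ, x ⬝ᵥ (A *ᵥ x) = ∑ i, ∑ j, w i * w j * A (f i) (f j) := by
  set x : n → ℝ := fun v => ∑ i, if f i = v then w i else 0 with hxdef
  have hx : ∀ i, x (f i) = w i := fun i => by simp [hxdef, hf.eq_iff]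
  have hxg : ∀ g : n → ℝ, x ⬝ᵥ g = ∑ i, w i * g (f i) := by
    intro g
    simp only [hxdef, dotProduct, Finset.sum_mul]
    rw [Finset.sum_comm]
    simp
  refine ⟨x, hxg, by simp [hxg, hx, sq], fun A => ?_⟩
  rw [hxg]
  refine Finset.sum_congr rfl fun i _ => ?_
  rw [mulVec, dotProduct_comm, hxg, Finset.mul_sum]
  exact Finset.sum_congr rfl fun j _ => by ring

-- Extension by zero turns the form of a principal submatrix into the form of `A`, whose
-- coefficients in an eigenbasis are all at least `c`.
open Matrix in
theorem sum_principal_ge {n : Type*} [Fintype n] [DecidableEq n] {A : Matrix n n ℝ}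
    (hA : A.IsHermitian) {c : ℝ} (hc : ∀ i, c ≤ hA.eigenvalues₀ i) {k : ℕ}
    {f : Fin k → n} (hf : Function.Injective f) (w : Fin k → ℝ) :
    c * ∑ i, w i ^ 2 ≤ ∑ i, ∑ j, w i * w j * A (f i) (f j) := by
  obtain ⟨e, he⟩ := exists_spectral_expansion hA
  obtain ⟨x, -, h1, h2⟩ := exists_extension_of_injective hf w
  rw [← h1, ← h2 A, (he x).1, (he x).2, Finset.mul_sum]
  exact Finset.sum_le_sum fun i _ => mul_le_mul_of_nonneg_right (hc i) (sq_nonneg _)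

open Matrix in
/-- If the third largest eigenvalue of `A` is at most `c`, then every three-parameter family of
vectors supported on `k` coordinates contains a nontrivial member at which the form of `A` is at
most `c` times the squared norm. -/
theorem exists_sum_principal_le {n : Type*} [Fintype n] [DecidableEq n] {A : Matrix n n ℝ}
    (hA : A.IsHermitian) {c : ℝ} (hn : 2 < Fintype.card n)
    (hc : hA.eigenvalues₀ ⟨2, hn⟩ ≤ c) {k : ℕ}
    {f : Fin k → n} (hf : Function.Injective f) (W : Matrix (Fin k) (Fin 3) ℝ) :
    ∃ α : Fin 3 → ℝ, α ≠ 0 ∧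
      ∑ i, ∑ j, (W *ᵥ α) i * (W *ᵥ α) j * A (f i) (f j) ≤ c * ∑ i, (W *ᵥ α) i ^ 2 := by
  obtain ⟨e, he⟩ := exists_spectral_expansion hA
  -- Orthogonality to the top two eigenvectors is two linear conditions on three parameters.
  let M : Matrix (Fin 2) (Fin k) ℝ :=
    Matrix.of fun r i => e ⟨r, by omega⟩ (f i)
  have hlt : Module.finrank ℝ (Fin 2 → ℝ) < Module.finrank ℝ (Fin 3 → ℝ) := by simp
  obtain ⟨α, hα, hα0⟩ := (Submodule.ne_bot_iff _).1
    (LinearMap.ker_ne_bot_of_finrank_lt (f := (M * W).mulVecLin) hlt)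
  refine ⟨α, hα0, ?_⟩
  have hM : M *ᵥ (W *ᵥ α) = 0 := by simpa using hα
  set w := W *ᵥ α
  obtain ⟨x, hxg, h1, h2⟩ := exists_extension_of_injective hf w
  rw [← h1, ← h2 A, (he x).1, (he x).2, Finset.mul_sum]
  refine Finset.sum_le_sum fun i _ => ?_
  by_cases hi : (i : ℕ) < 2
  · have h0 : e i ⬝ᵥ x = 0 := by
      have := congrFun hM ⟨i, hi⟩
      rw [dotProduct_comm, hxg]
      simpa [M, mulVec, dotProduct, mul_comm] using this
    simp [h0]
  · refine mul_le_mul_of_nonneg_right (le_trans (hA.eigenvalues₀_antitone ?_) hc) (sq_nonneg _)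
    exact Fin.mk_le_of_le_val (by omega)

/-! ### Diameter two and the form `J + A(Gᶜ)`. -/

namespace SimpleGraph

variable {V : Type*} {G : SimpleGraph V}

theorem Connected.exists_geodesic_of_three_le_dist (hG : G.Connected) {x y : V}
    (h : 3 ≤ G.dist x y) :
    ∃ a b c d : V, G.dist a b = 1 ∧ G.dist b c = 1 ∧ G.dist c d = 1 ∧
      G.dist a c = 2 ∧ G.dist b d = 2 ∧ G.dist a d = 3 := by
  obtain ⟨p, hp⟩ := hG.exists_walk_length_eq_dist x y
  -- Initial segments of a shortest walk are shortest.
  have key : ∀ i, i ≤ 3 → G.dist x (p.getVert i) = i := by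
    intro i hi
    have h1 := dist_le (p.take i)
    have h2 := dist_le (p.drop i)
    have h3 := hG.dist_triangle (u := x) (v := p.getVert i) (w := y)
    rw [Walk.take_length] at h1
    rw [Walk.drop_length] at h2
    omega
  have adj : ∀ i, i < 3 → G.dist (p.getVert i) (p.getVert (i + 1)) = 1 := fun i hi =>
    dist_eq_one_iff_adj.2 (p.adj_getVert_succ (by omega))
  have h1 := key 1 (by omega)
  have h3 := key 3 (by omega)
  have t1 := hG.dist_triangle (u := x) (v := p.getVert 1) (w := p.getVert 3)
  have t2 := hG.dist_triangle (u := p.getVert 1) (v := p.getVert 2) (w := p.getVert 3)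
  have a1 : G.dist (p.getVert 1) (p.getVert 2) = 1 := adj 1 (by omega)
  have a2 : G.dist (p.getVert 2) (p.getVert 3) = 1 := adj 2 (by omega)
  exact ⟨x, p.getVert 1, p.getVert 2, p.getVert 3, h1, a1, a2, key 2 (by omega), by omega, h3⟩

end SimpleGraph

namespace IsInDistanceClass

open SimpleGraph

variable {V : Type*} [Fintype V] [DecidableEq V] {G : SimpleGraph V}

theorem dist_le_two (hG : IsInDistanceClass G) (x y : V) : G.dist x y ≤ 2 := by
  by_contra hxy
  obtain ⟨a, b, c, d, hab, hbc, hcd, hac, hbd, had⟩ :=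
    hG.connected.exists_geodesic_of_three_le_dist (x := x) (y := y) (by omega)
  have hne : ∀ {u v : V} {k : ℕ}, G.dist u v = k + 1 → u ≠ v := by
    rintro u v k h rfl
    simp at h
  have hf : Function.Injective ![a, b, c, d] := by
    intro i j hij
    have := hne hab; have := hne hbc; have := hne hcd
    have := hne hac; have := hne hbd; have := hne had
    fin_cases i <;> fin_cases j <;> simp_all
  have hmin : ∀ i, -3 ≤ (distanceMatrix_isHermitian G).eigenvalues₀ i := fun i =>
    hG.neg_three_le_last.trans <| (distanceMatrix_isHermitian G).eigenvalues₀_antitone <|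
      Fin.mk_le_of_le_val (by simp; omega)
  -- An integer approximation to the eigenvector for `-2 - √2`: the form is `-34` and the squared
  -- norm `10`.
  have h := sum_principal_ge _ hmin hf ![2, 1, -1, -2]
  simp [Fin.sum_univ_four, distanceMatrix, G.dist_comm (u := b) (v := a),
    G.dist_comm (u := c) (v := b), G.dist_comm (u := d) (v := c), G.dist_comm (u := c) (v := a),
    G.dist_comm (u := d) (v := b), G.dist_comm (u := d) (v := a), hab, hbc, hcd, hac, hbd, had]
    at h
  norm_num at h

theorem dist_eq_two (hG : IsInDistanceClass G) {x y : V} (h : Gᶜ.Adj x y) : G.dist x y = 2 := by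
  rw [compl_adj] at h
  have := hG.dist_le_two x y
  have := hG.connected.one_lt_dist_of_ne_of_not_adj h.1 h.2
  omega

/-- Any two nonadjacent vertices have a common neighbour; in terms of the complement. -/
theorem exists_not_adj_not_adj (hG : IsInDistanceClass G) {x y : V} (h : Gᶜ.Adj x y) :
    ∃ z, x ≠ z ∧ y ≠ z ∧ ¬ Gᶜ.Adj x z ∧ ¬ Gᶜ.Adj y z := by
  have h2 := hG.dist_eq_two h
  obtain ⟨p, hp⟩ := hG.connected.exists_walk_length_eq_dist x y
  have h1 : G.Adj x (p.getVert 1) := by simpa using p.adj_getVert_succ (i := 0) (by omega)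
  have h3 : G.Adj (p.getVert 1) y := by
    have := p.adj_getVert_succ (i := 1) (by omega)
    rwa [show 1 + 1 = p.length by omega, p.getVert_length] at this
  exact ⟨p.getVert 1, h1.ne, h3.ne', fun h => (compl_adj _ _ _).1 h |>.2 h1,
    fun h => (compl_adj _ _ _).1 h |>.2 h3.symm⟩

/-- On a five-vertex set, the form of `D + 1` is `(∑ w)²` plus twice the sum of `w x * w y` over
the edges `xy` of the complement; it is not positive definite on any three-parameter family. -/
theorem exists_form_nonpos (hG : IsInDistanceClass G) {f : Fin 5 → V}
    (hf : Function.Injective f) (H : Fin 5 → Fin 5 → Bool)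
    (hH : ∀ i j, H i j = true ↔ Gᶜ.Adj (f i) (f j)) (W : Matrix (Fin 5) (Fin 3) ℝ) :
    ∃ α : Fin 3 → ℝ, α ≠ 0 ∧
      (∑ i, W.mulVec α i) ^ 2 +
        ∑ i, ∑ j, (bif H i j then W.mulVec α i * W.mulVec α j else 0) ≤ 0 := by
  obtain ⟨α, hα, h⟩ := exists_sum_principal_le (distanceMatrix_isHermitian G)
    (by have := hG.four_le_card; omega) hG.third_le_neg_one hf W
  refine ⟨α, hα, ?_⟩
  set w := W.mulVec α
  -- Entrywise form of `D = J + A(Gᶜ) - I`.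
  have hd : ∀ i j, w i * w j * distanceMatrix G (f i) (f j) =
      w i * w j + (bif H i j then w i * w j else 0) - (if i = j then w i * w j else 0) := by
    intro i j
    simp only [distanceMatrix, Matrix.of_apply]
    by_cases hij : i = j
    · subst hij
      have : H i i = false := by simpa using (hH i i).not.2 (by simp)
      simp [this]
    · by_cases hadj : Gᶜ.Adj (f i) (f j)
      · simp [hij, (hH i j).2 hadj, hG.dist_eq_two hadj]
        ring
      · have h1 : G.dist (f i) (f j) = 1 := by
          rw [dist_eq_one_iff_adj]
          by_contra hc
          exact hadj ((compl_adj _ _ _).2 ⟨hf.ne hij, hc⟩)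
        have : H i j = false := by simpa using (hH i j).not.2 hadj
        simp [hij, this, h1]
  simp only [hd, Finset.sum_add_distrib, Finset.sum_sub_distrib, Finset.sum_ite_eq,
    Finset.mem_univ, if_true, ← Finset.sum_mul_sum] at h
  simp only [← sq] at h
  linarith

/-- Variant of `exists_form_nonpos` with the vertices listed and the adjacencies explicit. -/
theorem exists_form_nonpos_of_vertices (hG : IsInDistanceClass G) {a b c d e : V}
    (hne : [a, b, c, d, e].Nodup) {hab hac had hae hbc hbd hbe hcd hce hde : Bool}
    (h1 : Gᶜ.Adj a b ↔ hab = true) (h2 : Gᶜ.Adj a c ↔ hac = true)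
    (h3 : Gᶜ.Adj a d ↔ had = true) (h4 : Gᶜ.Adj a e ↔ hae = true)
    (h5 : Gᶜ.Adj b c ↔ hbc = true) (h6 : Gᶜ.Adj b d ↔ hbd = true)
    (h7 : Gᶜ.Adj b e ↔ hbe = true) (h8 : Gᶜ.Adj c d ↔ hcd = true)
    (h9 : Gᶜ.Adj c e ↔ hce = true) (h10 : Gᶜ.Adj d e ↔ hde = true)
    (W : Matrix (Fin 5) (Fin 3) ℝ) :
    ∃ x y z : ℝ, (x, y, z) ≠ (0, 0, 0) ∧ ∃ w : Fin 5 → ℝ,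
      (∀ i, w i = W i 0 * x + W i 1 * y + W i 2 * z) ∧
      (w 0 + w 1 + w 2 + w 3 + w 4) ^ 2 + 2 * (
        (bif hab then w 0 * w 1 else 0) + (bif hac then w 0 * w 2 else 0) +
        (bif had then w 0 * w 3 else 0) + (bif hae then w 0 * w 4 else 0) +
        (bif hbc then w 1 * w 2 else 0) + (bif hbd then w 1 * w 3 else 0) +
        (bif hbe then w 1 * w 4 else 0) + (bif hcd then w 2 * w 3 else 0) +
        (bif hce then w 2 * w 4 else 0) + (bif hde then w 3 * w 4 else 0)) ≤ 0 := by
  have hf : Function.Injective ![a, b, c, d, e] := by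
    rw [← List.nodup_ofFn]
    simpa [List.ofFn_succ] using hne
  have hH : ∀ i j, (![![false, hab, hac, had, hae], ![hab, false, hbc, hbd, hbe],
      ![hac, hbc, false, hcd, hce], ![had, hbd, hcd, false, hde],
      ![hae, hbe, hce, hde, false]] : Fin 5 → Fin 5 → Bool) i j = true ↔
      Gᶜ.Adj (![a, b, c, d, e] i) (![a, b, c, d, e] j) := by
    intro i j
    fin_cases i <;> fin_cases j <;>
      first
        | exact h1.symm | exact h2.symm | exact h3.symm | exact h4.symm | exact h5.symm
        | exact h6.symm | exact h7.symm | exact h8.symm | exact h9.symm | exact h10.symm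
        | exact ((Gᶜ.adj_comm _ _).trans ‹_›).symm
        | exact iff_of_false (by simp) (Gᶜ.loopless.irrefl _)
  obtain ⟨α, hα, h⟩ := hG.exists_form_nonpos hf _ hH W
  refine ⟨α 0, α 1, α 2, fun h0 => hα ?_, W.mulVec α, fun i => ?_, ?_⟩
  · simp only [Prod.mk.injEq] at h0
    ext i
    fin_cases i
    exacts [h0.1, h0.2.1, h0.2.2]
  · simp [Matrix.mulVec, dotProduct, Fin.sum_univ_three]
  · simp only [Fin.sum_univ_five, mul_comm (W.mulVec α 1) (W.mulVec α 0)] at h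
    simp only [Matrix.cons_val, cond_false] at h
    simp only [mul_comm (W.mulVec α 2) (W.mulVec α 0), mul_comm (W.mulVec α 3) (W.mulVec α 0),
      mul_comm (W.mulVec α 4) (W.mulVec α 0), mul_comm (W.mulVec α 2) (W.mulVec α 1),
      mul_comm (W.mulVec α 3) (W.mulVec α 1), mul_comm (W.mulVec α 4) (W.mulVec α 1),
      mul_comm (W.mulVec α 3) (W.mulVec α 2), mul_comm (W.mulVec α 4) (W.mulVec α 2),
      mul_comm (W.mulVec α 4) (W.mulVec α 3)] at h
    linarith

end IsInDistanceClass

/-! ### Forbidden induced subgraphs of the complement. -/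

namespace IsInDistanceClass

open SimpleGraph

variable {V : Type*} [Fintype V] [DecidableEq V] {G : SimpleGraph V}

theorem not_compl_two_edges_and_isolated (hG : IsInDistanceClass G) {a b c d e : V}
    (hne : [a, b, c, d, e].Nodup)
    (hab : Gᶜ.Adj a b) (hcd : Gᶜ.Adj c d) (hac : ¬ Gᶜ.Adj a c) (had : ¬ Gᶜ.Adj a d)
    (hbc : ¬ Gᶜ.Adj b c) (hbd : ¬ Gᶜ.Adj b d) (hae : ¬ Gᶜ.Adj a e) (hbe : ¬ Gᶜ.Adj b e)
    (hce : ¬ Gᶜ.Adj c e) (hde : ¬ Gᶜ.Adj d e) : False := by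
  obtain ⟨x, y, z, h0, w, hw, h⟩ := hG.exists_form_nonpos_of_vertices hne
    (iff_of_true hab rfl) (iff_of_false hac Bool.false_ne_true)
    (iff_of_false had Bool.false_ne_true) (iff_of_false hae Bool.false_ne_true)
    (iff_of_false hbc Bool.false_ne_true) (iff_of_false hbd Bool.false_ne_true)
    (iff_of_false hbe Bool.false_ne_true) (iff_of_true hcd rfl)
    (iff_of_false hce Bool.false_ne_true) (iff_of_false hde Bool.false_ne_true)
    -- Constant on each edge, the form is `(2x + 2y + z)² + 2x² + 2y²`.
    !![1, 0, 0; 1, 0, 0; 0, 1, 0; 0, 1, 0; 0, 0, 1]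
  simp [hw] at h
  have hx : x = 0 := by nlinarith [sq_nonneg x, sq_nonneg y, sq_nonneg (x + x + y + y + z)]
  have hy : y = 0 := by nlinarith [sq_nonneg x, sq_nonneg y, sq_nonneg (x + x + y + y + z)]
  subst hx hy
  have hz : z = 0 := by nlinarith [sq_nonneg z]
  exact h0 (by rw [hz])

theorem not_compl_path_and_isolated (hG : IsInDistanceClass G) {a b c d e : V}
    (hne : [a, b, c, d, e].Nodup)
    (hab : Gᶜ.Adj a b) (hbc : Gᶜ.Adj b c) (hcd : Gᶜ.Adj c d) (hac : ¬ Gᶜ.Adj a c)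
    (had : ¬ Gᶜ.Adj a d) (hbd : ¬ Gᶜ.Adj b d) (hae : ¬ Gᶜ.Adj a e) (hbe : ¬ Gᶜ.Adj b e)
    (hce : ¬ Gᶜ.Adj c e) (hde : ¬ Gᶜ.Adj d e) : False := by
  obtain ⟨x, y, z, h0, w, hw, h⟩ := hG.exists_form_nonpos_of_vertices hne
    (iff_of_true hab rfl) (iff_of_false hac Bool.false_ne_true)
    (iff_of_false had Bool.false_ne_true) (iff_of_false hae Bool.false_ne_true)
    (iff_of_true hbc rfl) (iff_of_false hbd Bool.false_ne_true)
    (iff_of_false hbe Bool.false_ne_true) (iff_of_true hcd rfl)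
    (iff_of_false hce Bool.false_ne_true) (iff_of_false hde Bool.false_ne_true)
    -- The middle edge adds `2xy`, leaving `(2x + 2y + z)² + x² + y² + (x + y)²`.
    !![1, 0, 0; 1, 0, 0; 0, 1, 0; 0, 1, 0; 0, 0, 1]
  simp [hw] at h
  have hx : x = 0 := by
    nlinarith [sq_nonneg x, sq_nonneg y, sq_nonneg (x + y), sq_nonneg (x + x + y + y + z)]
  have hy : y = 0 := by
    nlinarith [sq_nonneg x, sq_nonneg y, sq_nonneg (x + y), sq_nonneg (x + x + y + y + z)]
  subst hx hy
  have hz : z = 0 := by nlinarith [sq_nonneg z]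
  exact h0 (by rw [hz])

theorem not_compl_path_five (hG : IsInDistanceClass G) {a b c d e : V}
    (hne : [a, b, c, d, e].Nodup)
    (hab : Gᶜ.Adj a b) (hbc : Gᶜ.Adj b c) (hcd : Gᶜ.Adj c d) (hde : Gᶜ.Adj d e)
    (hac : ¬ Gᶜ.Adj a c) (had : ¬ Gᶜ.Adj a d) (hbd : ¬ Gᶜ.Adj b d) (hae : ¬ Gᶜ.Adj a e)
    (hbe : ¬ Gᶜ.Adj b e) (hce : ¬ Gᶜ.Adj c e) : False := by
  obtain ⟨x, y, z, h0, w, hw, h⟩ := hG.exists_form_nonpos_of_vertices hne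
    (iff_of_true hab rfl) (iff_of_false hac Bool.false_ne_true)
    (iff_of_false had Bool.false_ne_true) (iff_of_false hae Bool.false_ne_true)
    (iff_of_true hbc rfl) (iff_of_false hbd Bool.false_ne_true)
    (iff_of_false hbe Bool.false_ne_true) (iff_of_true hcd rfl)
    (iff_of_false hce Bool.false_ne_true) (iff_of_true hde rfl)
    -- The first column is odd and the others even under reversing the path, so `x` has no cross
    -- terms; the first two columns sum to zero, so `J` contributes only `z²`.
    !![1, -4, 0; 1, 1, 0; 0, 6, 1; -1, 1, 0; -1, -4, 0]
  simp [hw] at h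
  have e : 4 * x ^ 2 + 4 * y ^ 2 + (z + 2 * y) ^ 2 ≤ 0 := by linarith
  have hx : x = 0 := by nlinarith [sq_nonneg x, sq_nonneg y, sq_nonneg (z + 2 * y)]
  have hy : y = 0 := by nlinarith [sq_nonneg x, sq_nonneg y, sq_nonneg (z + 2 * y)]
  subst hx hy
  have hz : z = 0 := by nlinarith [sq_nonneg z]
  exact h0 (by rw [hz])

theorem not_compl_cycle_five (hG : IsInDistanceClass G) {a b c d e : V}
    (hne : [a, b, c, d, e].Nodup)
    (hab : Gᶜ.Adj a b) (hbc : Gᶜ.Adj b c) (hcd : Gᶜ.Adj c d) (hde : Gᶜ.Adj d e)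
    (hae : Gᶜ.Adj a e) (hac : ¬ Gᶜ.Adj a c) (had : ¬ Gᶜ.Adj a d) (hbd : ¬ Gᶜ.Adj b d)
    (hbe : ¬ Gᶜ.Adj b e) (hce : ¬ Gᶜ.Adj c e) : False := by
  obtain ⟨x, y, z, h0, w, hw, h⟩ := hG.exists_form_nonpos_of_vertices hne
    (iff_of_true hab rfl) (iff_of_false hac Bool.false_ne_true)
    (iff_of_false had Bool.false_ne_true) (iff_of_true hae rfl)
    (iff_of_true hbc rfl) (iff_of_false hbd Bool.false_ne_true)
    (iff_of_false hbe Bool.false_ne_true) (iff_of_true hcd rfl)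
    (iff_of_false hce Bool.false_ne_true) (iff_of_true hde rfl)
    -- The all-ones vector, and integer stand-ins for the sine and cosine eigenvectors of the cycle
    -- for `2 cos (2π/5) > 0`; the form becomes diagonal.
    !![1, -2, 1; 1, 1, 1; 0, 2, 1; -1, 1, 1; -1, -2, 1]
  simp [hw] at h
  have e : 2 * x ^ 2 + 8 * y ^ 2 + 35 * z ^ 2 ≤ 0 := by linarith
  have hx : x = 0 := by nlinarith [sq_nonneg x, sq_nonneg y, sq_nonneg z]
  have hy : y = 0 := by nlinarith [sq_nonneg x, sq_nonneg y, sq_nonneg z]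
  have hz : z = 0 := by nlinarith [sq_nonneg x, sq_nonneg y, sq_nonneg z]
  exact h0 (by rw [hx, hy, hz])

theorem not_compl_paw_and_isolated (hG : IsInDistanceClass G) {a b c d e : V}
    (hne : [a, b, c, d, e].Nodup)
    (hab : Gᶜ.Adj a b) (hbc : Gᶜ.Adj b c) (hac : Gᶜ.Adj a c) (had : Gᶜ.Adj a d)
    (hbd : ¬ Gᶜ.Adj b d) (hcd : ¬ Gᶜ.Adj c d) (hae : ¬ Gᶜ.Adj a e) (hbe : ¬ Gᶜ.Adj b e)
    (hce : ¬ Gᶜ.Adj c e) (hde : ¬ Gᶜ.Adj d e) : False := by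
  obtain ⟨x, y, z, h0, w, hw, h⟩ := hG.exists_form_nonpos_of_vertices hne
    (iff_of_true hab rfl) (iff_of_true hac rfl)
    (iff_of_true had rfl) (iff_of_false hae Bool.false_ne_true)
    (iff_of_true hbc rfl) (iff_of_false hbd Bool.false_ne_true)
    (iff_of_false hbe Bool.false_ne_true) (iff_of_false hcd Bool.false_ne_true)
    (iff_of_false hce Bool.false_ne_true) (iff_of_false hde Bool.false_ne_true)
    -- Weight 2 on the pendant vertex supplies the extra `x²`; weight 1 would leave only `(x + y)²`
    -- besides the square of the sum.
    !![1, 0, 0; 0, 1, 0; 0, 1, 0; 2, 0, 0; 0, 0, 1]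
  simp [hw] at h
  have e : (3 * x + 2 * y + z) ^ 2 + 2 * (x ^ 2 + (x + y) ^ 2) ≤ 0 := by linarith
  have hx : x = 0 := by
    nlinarith [sq_nonneg x, sq_nonneg (x + y), sq_nonneg (3 * x + 2 * y + z)]
  subst hx
  have hy : y = 0 := by nlinarith [sq_nonneg y, sq_nonneg (3 * 0 + 2 * y + z)]
  subst hy
  have hz : z = 0 := by nlinarith [sq_nonneg z]
  exact h0 (by rw [hz])

/-- The complement contains no induced path on four vertices. -/
theorem not_compl_path_four (hG : IsInDistanceClass G) {a b c d : V}
    (hab : Gᶜ.Adj a b) (hbc : Gᶜ.Adj b c) (hcd : Gᶜ.Adj c d)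
    (hac : ¬ Gᶜ.Adj a c) (hbd : ¬ Gᶜ.Adj b d) (had : ¬ Gᶜ.Adj a d) : False := by
  -- Since `x` misses the middle edge, its adjacency to the ends `a` and `d` decides between `C₅`,
  -- `P₅` and `P₄ ∪ K₁`.
  obtain ⟨x, hbx, hcx, hnb, hnc⟩ := hG.exists_not_adj_not_adj hbc
  have hac' : a ≠ c := by rintro rfl; exact had hcd
  have hbd' : b ≠ d := by rintro rfl; exact had hab
  have had' : a ≠ d := by rintro rfl; exact hac hcd.symm
  have hax : a ≠ x := by rintro rfl; exact hnb hab.symm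
  have hdx : d ≠ x := by rintro rfl; exact hnc hcd
  have := hab.ne; have := hbc.ne; have := hcd.ne
  by_cases h1 : Gᶜ.Adj a x <;> by_cases h2 : Gᶜ.Adj d x
  · exact hG.not_compl_cycle_five (a := a) (b := b) (c := c) (d := d) (e := x)
      (by simp; tauto) hab hbc hcd h2 h1 hac had hbd hnb hnc
  · exact hG.not_compl_path_five (a := x) (b := a) (c := b) (d := c) (e := d)
      (by simp; tauto) h1.symm hab hbc hcd (fun h => hnb h.symm) (fun h => hnc h.symm) hac
      (fun h => h2 h.symm) had hbd
  · exact hG.not_compl_path_five (a := a) (b := b) (c := c) (d := d) (e := x)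
      (by simp; tauto) hab hbc hcd h2 hac had hbd h1 hnb hnc
  · exact hG.not_compl_path_and_isolated (a := a) (b := b) (c := c) (d := d) (e := x)
      (by simp; tauto) hab hbc hcd hac had hbd h1 hnb hnc h2

/-- The complement contains no induced paw (a triangle `abc` with a pendant vertex `d` at `a`). -/
theorem not_compl_paw (hG : IsInDistanceClass G) {a b c d : V}
    (hab : Gᶜ.Adj a b) (hbc : Gᶜ.Adj b c) (hac : Gᶜ.Adj a c) (had : Gᶜ.Adj a d)
    (hbd : ¬ Gᶜ.Adj b d) (hcd : ¬ Gᶜ.Adj c d) : False := by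
  obtain ⟨x, hax, hbx, hna, hnb⟩ := hG.exists_not_adj_not_adj hab
  have hbd' : b ≠ d := by rintro rfl; exact hcd hbc.symm
  have hcd' : c ≠ d := by rintro rfl; exact hbd hbc
  have hcx' : c ≠ x := by rintro rfl; exact hna hac
  have hdx' : d ≠ x := by rintro rfl; exact hna had
  have := hab.ne; have := hbc.ne; have := hac.ne; have := had.ne
  -- An edge from `x` to `d` or `c` would create an induced `P₄`, so `x` is isolated from the paw.
  have hdx : ¬ Gᶜ.Adj d x := fun h =>
    hG.not_compl_path_four h.symm had.symm hab (fun h => hna h.symm) (fun h => hbd h.symm)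
      (fun h => hnb h.symm)
  have hcx : ¬ Gᶜ.Adj c x := fun h =>
    hG.not_compl_path_four h.symm hac.symm had (fun h => hna h.symm) hcd
      (fun h => hdx h.symm)
  exact hG.not_compl_paw_and_isolated (a := a) (b := b) (c := c) (d := d) (e := x)
    (by simp; tauto) hab hbc hac had hbd hcd hna hnb hcx hdx

/-- In each component of the complement, every vertex is adjacent to an end of every edge. -/
theorem compl_adj_or_adj_of_reachable (hG : IsInDistanceClass G) {a c b : V}
    (hac : Gᶜ.Adj a c) (hab : Gᶜ.Reachable a b) : Gᶜ.Adj a b ∨ Gᶜ.Adj c b := by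
  obtain ⟨p⟩ := hab.symm
  induction p with
  | nil => exact Or.inr hac.symm
  | @cons y b a hyb q ih =>
    have hb := ih hac
    by_contra! hy
    -- Here `y` is adjacent to `b` but to neither end of `ac`: if `b` sees both ends there is a paw,
    -- if one, an induced `P₄`.
    rcases em (Gᶜ.Adj a b) with h1 | h1 <;> rcases em (Gᶜ.Adj c b) with h2 | h2
    · exact hG.not_compl_paw (a := b) (b := a) (c := c) (d := y) h1.symm hac h2.symm hyb.symm
        hy.1 hy.2
    · exact hG.not_compl_path_four (a := y) (b := b) (c := a) (d := c) hyb h1.symm hac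
        (fun h => hy.1 h.symm) (fun h => h2 h.symm) (fun h => hy.2 h.symm)
    · exact hG.not_compl_path_four (a := y) (b := b) (c := c) (d := a) hyb h2.symm hac.symm
        (fun h => hy.2 h.symm) (fun h => h1 h.symm) (fun h => hy.1 h.symm)
    · tauto

end IsInDistanceClass

/-! ### Disjoint unions of cliques, and joins. -/

/-- A finite graph in which adjacency-or-equality is transitive is a disjoint union of complete
graphs. -/
theorem exists_iso_unionOfCompleteGraphs {W : Type*} [Finite W] (G : SimpleGraph W)
    (htrans : ∀ x y z, G.Adj x y → G.Adj y z → x ≠ z → G.Adj x z)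
    {a b : W} (hab : a ≠ b) (hnadj : ¬ G.Adj a b) :
    ∃ (i : ℕ) (s : Fin i → ℕ), 2 ≤ i ∧ (∀ k, 1 ≤ s k) ∧
      Nonempty (G ≃g unionOfCompleteGraphs s) := by
  classical
  let S : Setoid W :=
    { r := fun x y => x = y ∨ G.Adj x y
      iseqv := ⟨fun x => Or.inl rfl, fun h => h.imp Eq.symm SimpleGraph.Adj.symm, by
        rintro x y z (rfl | hxy) (rfl | hyz)
        · exact Or.inl rfl
        · exact Or.inr hyz
        · exact Or.inr hxy
        · by_cases h : x = z
          · exact Or.inl h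
          · exact Or.inr (htrans x y z hxy hyz h)⟩ }
  have hS : ∀ x y, (Quotient.mk S x = Quotient.mk S y) ↔ (x = y ∨ G.Adj x y) :=
    fun x y => Quotient.eq (r := S)
  let Q := Quotient S
  let e : Q ≃ Fin (Nat.card Q) := Finite.equivFin Q
  let s : Fin (Nat.card Q) → ℕ := fun k => Nat.card {w : W // e (Quotient.mk S w) = k}
  let f : W ≃ Σ k, Fin (s k) :=
    (Equiv.sigmaFiberEquiv fun w : W => e (Quotient.mk S w)).symm.trans
      (Equiv.sigmaCongrRight fun _ => Finite.equivFin _)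
  have hf : ∀ w, (f w).1 = e (Quotient.mk S w) := fun w => rfl
  refine ⟨Nat.card Q, s, ?_, fun k => ?_, ⟨⟨f, fun {x y} => ?_⟩⟩⟩
  · have : Nontrivial Q := ⟨Quotient.mk S a, Quotient.mk S b, fun h => by
      rcases (hS a b).1 h with h | h
      exacts [hab h, hnadj h]⟩
    exact Finite.one_lt_card
  · obtain ⟨w, hw⟩ := Quotient.exists_rep (e.symm k)
    have : Nonempty {w : W // e (Quotient.mk S w) = k} := ⟨⟨w, by
      rw [hw, Equiv.apply_symm_apply]⟩⟩
    exact Nat.card_pos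
  · change (f x ≠ f y ∧ (f x).1 = (f y).1) ↔ _
    rw [hf, hf, e.apply_eq_iff_eq, hS, f.injective.ne_iff]
    constructor
    · rintro ⟨h, h' | h'⟩
      exacts [absurd h' h, h']
    · exact fun h => ⟨h.ne, Or.inr h⟩

/-- Joins are invariant under isomorphism of the two parts. -/
def graphJoinCongr {V V' W W' : Type*} {G : SimpleGraph V} {G' : SimpleGraph V'}
    {H : SimpleGraph W} {H' : SimpleGraph W'} (f : G ≃g G') (g : H ≃g H') :
    graphJoin G H ≃g graphJoin G' H' where
  toEquiv := Equiv.sumCongr f.toEquiv g.toEquiv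
  map_rel_iff' := by
    rintro (x | x) (y | y) <;> simp [graphJoin, f.map_adj_iff, g.map_adj_iff]

/-- A graph in which every vertex of `P` is adjacent to every vertex outside `P` is the join of the
graphs induced on `P` and on its complement. -/
noncomputable def isoGraphJoinInduce {V : Type*} (G : SimpleGraph V) (P : Set V)
    (h : ∀ x ∈ P, ∀ y ∉ P, G.Adj x y) :
    graphJoin (G.induce P) (G.induce Pᶜ) ≃g G where
  toEquiv := by
    classical exact Equiv.Set.sumCompl P
  map_rel_iff' := by
    rintro (⟨x, hx⟩ | ⟨x, hx⟩) (⟨y, hy⟩ | ⟨y, hy⟩)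
    · simp [graphJoin]
    · simpa [graphJoin] using h x hx y hy
    · simpa [graphJoin] using (h y hy x hx).symm
    · simp [graphJoin]

/-! ### Components of the complement and the classification. -/

namespace IsInDistanceClass

open SimpleGraph

variable {V : Type*} [Fintype V] [DecidableEq V] {G : SimpleGraph V}

/-- A component of the complement with an edge induces a disjoint union of at least two complete
graphs. -/
theorem exists_iso_induce_component (hG : IsInDistanceClass G) {a b : V} (hab : Gᶜ.Adj a b)
    {P : Set V} (hP : ∀ x, x ∈ P ↔ Gᶜ.Reachable a x) :
    ∃ (i : ℕ) (s : Fin i → ℕ), 2 ≤ i ∧ (∀ k, 1 ≤ s k) ∧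
      Nonempty (G.induce P ≃g unionOfCompleteGraphs s) := by
  refine exists_iso_unionOfCompleteGraphs (G.induce P) ?_
    (a := ⟨a, (hP a).2 (Reachable.refl a)⟩) (b := ⟨b, (hP b).2 hab.reachable⟩) ?_ ?_
  · rintro ⟨x, hx⟩ ⟨y, hy⟩ ⟨z, hz⟩ hxy hyz hxz
    simp only [comap_adj, Function.Embedding.subtype_apply, ne_eq, Subtype.mk.injEq]
      at hxy hyz hxz ⊢
    by_contra hc
    -- Otherwise `xz` is an edge of `Gᶜ` in the component of `y`, with neither end adjacent to `y`
    -- there.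
    rcases hG.compl_adj_or_adj_of_reachable ((compl_adj _ _ _).2 ⟨hxz, hc⟩)
      (((hP x).1 hx).symm.trans ((hP y).1 hy)) with h | h
    · exact ((compl_adj _ _ _).1 h).2 hxy
    · exact ((compl_adj _ _ _).1 h).2 hyz.symm
  · simpa using hab.ne
  · simpa using ((compl_adj _ _ _).1 hab).2

end IsInDistanceClass

open SimpleGraph in
theorem corollary3p13 {V : Type*} [Fintype V] [DecidableEq V] (G : SimpleGraph V)
    (hG : IsInDistanceClass G) :
    (∃ (r i : ℕ) (s : Fin i → ℕ), 1 ≤ r ∧ 2 ≤ i ∧ (∀ k, 1 ≤ s k) ∧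
      Nonempty (G ≃g graphJoin (SimpleGraph.completeGraph (Fin r)) (unionOfCompleteGraphs s))) ∨
    (∃ (i j : ℕ) (s : Fin i → ℕ) (t : Fin j → ℕ), 2 ≤ i ∧ 2 ≤ j ∧
      (∀ k, 1 ≤ s k) ∧ (∀ k, 1 ≤ t k) ∧
      Nonempty (G ≃g graphJoin (unionOfCompleteGraphs s) (unionOfCompleteGraphs t))) := by
  obtain ⟨a, b, hab⟩ := SimpleGraph.ne_bot_iff_exists_adj.1
    (show Gᶜ ≠ ⊥ from fun h => hG.not_complete (compl_eq_bot.1 h))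
  let P : Set V := {x | ¬ Gᶜ.Reachable a x}
  have hPc : ∀ x, x ∈ Pᶜ ↔ Gᶜ.Reachable a x := fun x => not_not
  have hcross : ∀ x ∈ P, ∀ y ∉ P, G.Adj x y := by
    intro x hx y hy
    have hy' := (hPc y).1 hy
    by_contra hc
    refine hx (hy'.trans (Adj.reachable ((compl_adj _ _ _).2 ⟨?_, fun h => hc h.symm⟩)))
    rintro rfl
    exact hx hy'
  obtain ⟨i, s, hi, hs, ⟨f⟩⟩ := hG.exists_iso_induce_component hab hPc
  by_cases hedge : ∃ c ∈ P, ∃ d ∈ P, Gᶜ.Adj c d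
  · obtain ⟨c, hc, d, hd, hcd⟩ := hedge
    -- A vertex outside the components of `a` and `c` would form `2K₂ ∪ K₁` with the edges `ab` and
    -- `cd`.
    have hP : ∀ x, x ∈ P ↔ Gᶜ.Reachable c x := by
      refine fun x => ⟨fun hx => ?_, fun hx hax => hc (hax.trans hx.symm)⟩
      by_contra hcx
      have hab' := hab.reachable
      have hcd' := hcd.reachable
      have hnot : ∀ {u v : V}, ¬ Gᶜ.Reachable u v → u ≠ v ∧ ¬ Gᶜ.Adj u v := fun h =>
        ⟨by rintro rfl; exact h (Reachable.refl _), fun h' => h h'.reachable⟩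
      have hac := hnot hc
      have had := hnot hd
      have hax := hnot hx
      have hbc := hnot fun h => hc (hab'.trans h)
      have hbd := hnot fun h => hd (hab'.trans h)
      have hbx := hnot fun h => hx (hab'.trans h)
      have hcx' := hnot hcx
      have hdx := hnot fun h => hcx (hcd'.trans h)
      have := hab.ne
      have := hcd.ne
      exact hG.not_compl_two_edges_and_isolated (a := a) (b := b) (c := c) (d := d) (e := x)
        (by simp; tauto) hab hcd hac.2 had.2 hbc.2 hbd.2 hax.2 hbx.2 hcx'.2 hdx.2
    obtain ⟨j, t, hj, ht, ⟨g⟩⟩ := hG.exists_iso_induce_component hcd hP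
    exact Or.inr ⟨j, i, t, s, hj, hi, ht, hs,
      ⟨(isoGraphJoinInduce G P hcross).symm.trans (graphJoinCongr g f)⟩⟩
  · have htop : G.induce P = completeGraph P := by
      ext ⟨x, hx⟩ ⟨y, hy⟩
      simp only [comap_adj, Function.Embedding.subtype_apply, completeGraph, top_adj, ne_eq,
        Subtype.mk.injEq]
      refine ⟨fun h => h.ne, fun h => ?_⟩
      by_contra hc
      exact hedge ⟨x, hx, y, hy, (compl_adj _ _ _).2 ⟨h, hc⟩⟩
    -- A common neighbour of `a` and `b` in `G` lies outside their component of `Gᶜ`, whence `r ≥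
    -- 1`.
    obtain ⟨z, hza, hzb, hna, hnb⟩ := hG.exists_not_adj_not_adj hab
    have hz : z ∈ P := fun h => (hG.compl_adj_or_adj_of_reachable hab h).elim hna hnb
    have : Nonempty P := ⟨⟨z, hz⟩⟩
    exact Or.inl ⟨Nat.card P, i, s, Nat.card_pos, hi, hs,
      ⟨(isoGraphJoinInduce G P hcross).symm.trans
        (graphJoinCongr (htop ▸ Iso.completeGraph (Finite.equivFin P)) f)⟩⟩
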